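/- Let $G$ be a connected compact metric graph with finitely many edges $e$, each identified with an interval of finite length $|e|>0$ (loops and multiple edges are allowed). Let $L=\sum_e |e|$ be its total length and $D=\sup\{\operatorname{dist}(x,y): x,y\in G\}$ its diameter, where $\operatorname{dist}(x,y)$ is the length of a shortest path in $G$ from $x$ to $y$ and the supremum is over all points of $G$, not only vertices. Let $-\Delta$ be the Laplacian on $G$, acting as $u\mapsto -u''$ on each edge, on functions that are continuous at the vertices and whose derivatives at each vertex, taken in the directions pointing from the vertex into the edges, sum up to $0$. Let $\lambda_1(G)$ be its lowest nonzero eigenvalue, which is also given by $$\lambda_1(G)=\inf\left\{\frac{\int_G |u'|^2\,dx}{\int_G |u|^2\,dx} : 0\neq u\in H^1(G),\ \int_G u\,dx=0\right\},$$ where $H^1(G)$ is the space of functions on $G$ that are in $H^1$ on each edge and continuous at the vertices. Theorem. If $D>0$ and $L\ge 2D$, then the equation $$\cos(2\kappa D)=(L-2D)\,\kappa\,\sin(2\kappa D)$$ has a smallest positive solution $\kappa$, and $$\lambda_1(G)\ge\kappa^2 .$$ In particular, $$\lambda_1(G)\ \ge\ \frac{1}{2D(L-D)}\ >\ \frac{1}{2DL}.$$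 The lower bounds hold both for the infimum of the Rayleigh quotient above and for every nonzero eigenvalue of $-\Delta$. -/

import Mathlib

open MeasureTheory

noncomputable section

/-- A metric graph with vertex set `V` and edge set `E`: the edge `e` is identified with the
interval `[0, len e]`, its endpoint `0` being glued to the vertex `src e` and its endpoint `len e`
to the vertex `tgt e`. Loops and multiple edges are allowed. -/
structure MetricGraph (V E : Type*) where
  src : E → V
  tgt : E → V
  len : E → ℝ
  len_pos : ∀ e, 0 < len e

namespace MetricGraph

variable {V E : Type*} (G : MetricGraph V E)

/-- The graph is non-empty and any two vertices are joined by a chain of edges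
(traversed in either direction). -/
def Connected : Prop :=
  Nonempty V ∧ ∀ v w : V, Relation.EqvGen (fun a b => ∃ e, G.src e = a ∧ G.tgt e = b) v w

/-- The total length `L(G)`. -/
def totalLength [Fintype E] : ℝ := ∑ e, G.len e

/-! ### Points, distance and diameter -/

/-- Points of the graph, given by an edge and a coordinate on it. Endpoints of edges which
are glued to the same vertex represent the same point of the graph. -/
structure Point where
  edge : E
  coord : ℝ
  mem : coord ∈ Set.Icc 0 (G.len edge)

/-- `x` represents the vertex `v`. -/
def Point.IsAt {G : MetricGraph V E} (x : G.Point) (v : V) : Prop :=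
  (x.coord = 0 ∧ G.src x.edge = v) ∨ (x.coord = G.len x.edge ∧ G.tgt x.edge = v)

/-- `G.HasPath x y ℓ`: there is a path from `x` to `y` of length `ℓ`, composed of finitely many
segments inside edges. Passing through a vertex from one edge to another costs nothing. -/
inductive HasPath : G.Point → G.Point → ℝ → Prop
  | segment (x y : G.Point) (h : x.edge = y.edge) : HasPath x y |x.coord - y.coord|
  | vertex (x y : G.Point) (v : V) (hx : x.IsAt v) (hy : y.IsAt v) : HasPath x y 0
  | trans (x y z : G.Point) (a b : ℝ) (hxy : HasPath x y a) (hyz : HasPath y z b) :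
      HasPath x z (a + b)

/-- The distance: the infimum of the lengths of the paths from `x` to `y`. -/
def dist (x y : G.Point) : ℝ := sInf {ℓ | G.HasPath x y ℓ}

/-- The diameter `D(G)`, the supremum of the distances of all pairs of points (not only
vertices). -/
def diameter : ℝ := sSup {d | ∃ x y : G.Point, d = G.dist x y}

/-! ### Sobolev functions -/

/-- `f` is absolutely continuous on `[0, a]` with (weak) derivative `g ∈ L²(0, a)`; that is,
`f` is the continuous representative of an element of `H¹(0, a)` and `g` represents `f'`. -/
def HasH1Deriv (a : ℝ) (f g : ℝ → ℝ) : Prop :=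
  MemLp g 2 (volume.restrict (Set.Ioc 0 a)) ∧
    ∀ x ∈ Set.Icc 0 a, f x = f 0 + ∫ t in (0 : ℝ)..x, g t

/-- `u ∈ H¹(G)` with derivative `u'`: on each edge `u` is in `H¹` with derivative `u'`, and `u` is
continuous at the vertices. Only the values of `u e` on `[0, len e]` matter. -/
def IsH1 (u u' : E → ℝ → ℝ) : Prop :=
  (∀ e, HasH1Deriv (G.len e) (u e) (u' e)) ∧
    ∃ c : V → ℝ, ∀ e, u e 0 = c (G.src e) ∧ u e (G.len e) = c (G.tgt e)

/-- The integral over the graph. -/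
def integral [Fintype E] (f : E → ℝ → ℝ) : ℝ := ∑ e, ∫ x in (0 : ℝ)..(G.len e), f e x

/-- `λ₁(G)`, the infimum of the Rayleigh quotient over the nonzero functions in `H¹(G)` that are
orthogonal to the constants. -/
def lambda1 [Fintype E] : ℝ :=
  sInf {r | ∃ u u' : E → ℝ → ℝ, G.IsH1 u u' ∧ G.integral u = 0 ∧
    0 < G.integral (fun e x => u e x ^ 2) ∧
    r = G.integral (fun e x => u' e x ^ 2) / G.integral (fun e x => u e x ^ 2)}

/-! ### The Laplacian with natural vertex conditions -/

open Classical in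
/-- The Kirchhoff condition: at each vertex the derivatives of `u` in the directions pointing from
the vertex into the edges sum up to `0` (a loop contributes at both of its ends). -/
def Kirchhoff [Fintype E] (u' : E → ℝ → ℝ) : Prop :=
  ∀ v : V, ((∑ e, if G.src e = v then u' e 0 else 0) +
    ∑ e, if G.tgt e = v then -u' e (G.len e) else 0) = 0

/-- `u` is in the domain of the Laplacian with continuity and Kirchhoff conditions, i.e. it is in
`H²` on each edge, continuous at the vertices and satisfies the Kirchhoff condition there, and
`-u'' = f`. -/
def HasNegLaplacian [Fintype E] (u f : E → ℝ → ℝ) : Prop :=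
  ∃ u' : E → ℝ → ℝ, G.IsH1 u u' ∧ G.Kirchhoff u' ∧
    ∀ e, HasH1Deriv (G.len e) (u' e) (fun x => -f e x)

/-- `μ` is an eigenvalue of `-Δ` on `G`. As the operator is self-adjoint with real coefficients,
eigenvalues are real and have real eigenfunctions. -/
def IsEigenvalue [Fintype E] (μ : ℝ) : Prop :=
  ∃ u : E → ℝ → ℝ, (∃ e, ∃ x ∈ Set.Icc 0 (G.len e), u e x ≠ 0) ∧
    G.HasNegLaplacian u (fun e x => μ * u e x)

end MetricGraph

end

/-! The proof avoids symmetrization: a Poincaré inequality with constant `2 / (D * L)` already beats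
`κ ^ 2`. For mean-zero `u`, integrating `(u x - u y) ^ 2 ≤ D * ‖u'‖²` over both variables gives `2 *
L * ‖u‖² ≤ L ^ 2 * D * ‖u'‖²` (`IsH1.poincare`). This bounds the Rayleigh quotient, and hence
nonzero eigenvalues by Green's identity. That `κ ^ 2 ≤ 2 / (D * L)` is elementary trigonometry
(`exists_isLeast_secular`).

The pointwise bound is Cauchy–Schwarz along a path (`HasPath.sq_sub_le`). A path may repeat edges,
so `u'` is not integrated along it: the values between `u x` and `u y` are covered by images of sets
`S e` of total measure at most the path length, and the image of `S e` has measure at most `∫ |u'|`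
over `S e`. Each point of the graph then counts once. -/

/-! ### Measure of images under absolutely continuous functions -/

/-- The image of a set under a function with integrable derivative bound `φ` has measure at most
the integral of `φ` over the set. -/
theorem volume_image_le_setIntegral {F φ : ℝ → ℝ} (hφ : Integrable φ) (hφ0 : 0 ≤ φ)
    (hF : ∀ x y, x ≤ y → |F y - F x| ≤ ∫ t in x..y, φ t) {s : Set ℝ} (hs : MeasurableSet s) :
    volume (F '' s) ≤ ENNReal.ofReal (∫ t in s, φ t) := by
  have hi : ∀ a b, IntervalIntegrable φ volume a b := fun a b => hφ.intervalIntegrable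
  have hsub : ∀ a b, (∫ t in (0 : ℝ)..b, φ t) - ∫ t in (0 : ℝ)..a, φ t = ∫ t in a..b, φ t :=
    fun a b => intervalIntegral.integral_interval_sub_left (hi _ _) (hi _ _)
  let h : StieltjesFunction ℝ :=
    { toFun := fun x => ∫ t in (0 : ℝ)..x, φ t
      mono' := fun x y hxy => by
        have := intervalIntegral.integral_nonneg (μ := volume) hxy fun t _ => hφ0 t
        have := hsub x y
        simp only
        linarith
      right_continuous' := fun x =>
        (intervalIntegral.continuous_primitive hi 0).continuousWithinAt }
  have hh : ∀ a b, h b - h a = ∫ t in a..b, φ t := hsub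
  have hmeas : h.measure = volume.withDensity fun t => ENNReal.ofReal (φ t) := by
    refine Measure.ext_of_Ioc _ _ fun a b hab => ?_
    rw [h.measure_Ioc, hh, withDensity_apply _ measurableSet_Ioc,
      intervalIntegral.integral_of_le hab.le,
      ofReal_integral_eq_lintegral_ofReal hφ.integrableOn (ae_of_all _ hφ0)]
  -- `h.outer` is the largest outer measure dominated by interval increments of `h`, so it suffices
  -- to bound the diameter of `F '' s` for `s` inside one interval.
  have hle : OuterMeasure.comap F volume.toOuterMeasure ≤ h.outer := by
    refine OuterMeasure.le_ofFunction.2 fun s => ?_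
    rw [OuterMeasure.comap_apply, h.length_eq]
    refine le_iInf fun a => le_iInf fun b => le_iInf fun hab => ?_
    have hab : s ⊆ Set.Ioc a b := by simpa [botSet] using hab
    rw [hh]
    refine (Real.volume_le_diam _).trans (Metric.ediam_le ?_)
    have key : ∀ x ∈ s, ∀ y ∈ s, x ≤ y →
        edist (F x) (F y) ≤ ENNReal.ofReal (∫ t in a..b, φ t) := by
      intro x hx y hy hxy
      rw [edist_comm, edist_dist, Real.dist_eq]
      refine ENNReal.ofReal_le_ofReal ((hF x y hxy).trans ?_)
      exact intervalIntegral.integral_mono_interval (hab hx).1.le hxy (hab hy).2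
        (ae_of_all _ hφ0) (hi _ _)
    rintro _ ⟨x, hx, rfl⟩ _ ⟨y, hy, rfl⟩
    rcases le_total x y with hxy | hxy
    · exact key x hx y hy hxy
    · rw [edist_comm]
      exact key y hy x hx hxy
  calc volume (F '' s) ≤ h.outer s := hle s
    _ = h.measure s := by rw [StieltjesFunction.measure]; rfl
    _ = ENNReal.ofReal (∫ t in s, φ t) := by
      rw [hmeas, withDensity_apply _ hs,
        ofReal_integral_eq_lintegral_ofReal hφ.integrableOn (ae_of_all _ hφ0)]

namespace MetricGraph

namespace HasH1Deriv

variable {a : ℝ} {f g : ℝ → ℝ}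

theorem integrableOn (h : HasH1Deriv a f g) : IntegrableOn g (Set.Ioc 0 a) :=
  h.1.integrable one_le_two

theorem continuousOn (h : HasH1Deriv a f g) : ContinuousOn f (Set.Icc 0 a) := by
  rcases lt_or_ge a 0 with ha | ha
  · simp [Set.Icc_eq_empty ha.not_ge]
  have hg : IntervalIntegrable g volume 0 a :=
    (intervalIntegrable_iff_integrableOn_Ioc_of_le ha).2 h.integrableOn
  have := intervalIntegral.continuousOn_primitive_interval' hg Set.left_mem_uIcc
  rw [Set.uIcc_of_le ha] at this
  exact (continuousOn_const.add this).congr h.2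

theorem volume_image_le (h : HasH1Deriv a f g) {s : Set ℝ} (hs : MeasurableSet s)
    (hsub : s ⊆ Set.Icc 0 a) : volume (f '' s) ≤ ENNReal.ofReal (∫ t in s, |g t|) := by
  -- Extension by zero makes the derivative integrable on the whole line.
  set γ : ℝ → ℝ := (Set.Ioc 0 a).indicator g with hγ
  have hγi : Integrable γ := (integrable_indicator_iff measurableSet_Ioc).2 h.integrableOn
  have hi : ∀ a b, IntervalIntegrable γ volume a b := fun a b => hγi.intervalIntegrable
  have hf : ∀ x ∈ Set.Icc 0 a, f x = f 0 + ∫ t in (0 : ℝ)..x, γ t := by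
    intro x hx
    rw [h.2 x hx]
    congr 1
    rw [intervalIntegral.integral_of_le hx.1, intervalIntegral.integral_of_le hx.1]
    refine setIntegral_congr_fun measurableSet_Ioc fun t ht => ?_
    have hta : t ∈ Set.Ioc 0 a := ⟨ht.1, ht.2.trans hx.2⟩
    exact (Set.indicator_of_mem hta g).symm
  rw [Set.image_congr fun x hx => hf x (hsub hx)]
  refine (volume_image_le_setIntegral hγi.abs (fun t => abs_nonneg _) ?_ hs).trans ?_
  · intro x y hxy
    rw [add_sub_add_left_eq_sub, intervalIntegral.integral_interval_sub_left (hi _ _) (hi _ _)]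
    exact intervalIntegral.abs_integral_le_integral_abs hxy
  · refine ENNReal.ofReal_le_ofReal (le_of_eq ?_)
    refine integral_congr_ae ?_
    have h0 : ∀ᵐ t ∂(volume.restrict s), t ≠ 0 :=
      ae_restrict_of_ae (by simp [ae_iff])
    filter_upwards [h0, ae_restrict_mem hs] with t ht hts
    have := hsub hts
    have hta : t ∈ Set.Ioc 0 a := ⟨lt_of_le_of_ne this.1 ht.symm, this.2⟩
    rw [hγ, Set.indicator_of_mem hta]

/-- Weighted Cauchy–Schwarz inequality for the derivative on a subset of the interval. -/
theorem setIntegral_abs_le (h : HasH1Deriv a f g) (ha : 0 ≤ a) {s : Set ℝ}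
    (hsub : s ⊆ Set.Icc 0 a) (r : ℝ) :
    2 * r * ∫ t in s, |g t| ≤ r ^ 2 * (∫ t in (0 : ℝ)..a, g t ^ 2) + volume.real s := by
  have hI2 : IntegrableOn (fun t => g t ^ 2) (Set.Icc 0 a) :=
    (integrableOn_Icc_iff_integrableOn_Ioc).2 h.1.integrable_sq
  have hI1 : IntegrableOn g (Set.Icc 0 a) :=
    (integrableOn_Icc_iff_integrableOn_Ioc).2 h.integrableOn
  have hfin : volume s ≠ ⊤ := ((measure_mono hsub).trans_lt (by simp)).ne
  have h1 : ∫ t in s, g t ^ 2 ≤ ∫ t in (0 : ℝ)..a, g t ^ 2 := by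
    rw [intervalIntegral.integral_of_le ha, ← integral_Icc_eq_integral_Ioc]
    exact setIntegral_mono_set hI2 (ae_of_all _ fun t => sq_nonneg _) (ae_of_all _ hsub)
  have hc : IntegrableOn (fun _ : ℝ => (1 : ℝ)) s := integrableOn_const hfin
  have h2 : ∫ t in s, 2 * r * |g t| ≤ ∫ t in s, (r ^ 2 * g t ^ 2 + 1) := by
    refine integral_mono ((hI1.mono_set hsub).abs.const_mul _)
      (((hI2.mono_set hsub).const_mul _).add hc) fun t => ?_
    have := sq_nonneg (r * |g t| - 1)
    rw [sub_sq, mul_pow, sq_abs] at this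
    simp only
    linarith
  rw [integral_const_mul, integral_add ((hI2.mono_set hsub).const_mul _) hc,
    integral_const_mul] at h2
  simp only [setIntegral_const, smul_eq_mul, mul_one] at h2
  have := mul_le_mul_of_nonneg_left h1 (sq_nonneg r)
  linarith

end HasH1Deriv

end MetricGraph

/-! ### The secular equation -/

theorem Real.mul_cos_le_sin_of_le_pi_div_two {t : ℝ} (h0 : 0 ≤ t) (h1 : t ≤ Real.pi / 2) :
    t * Real.cos t ≤ Real.sin t := by
  rcases h1.lt_or_eq with h1 | rfl
  · have hc : 0 < Real.cos t := Real.cos_pos_of_mem_Ioo ⟨by linarith, h1⟩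
    have := Real.le_tan h0 h1
    rwa [Real.tan_eq_sin_div_cos, le_div_iff₀ hc] at this
  · simp

/-- The secular equation `cos (2kD) = (L - 2D) k sin (2kD)` has a smallest positive solution, and
the square of that solution is at most `2 / (D L)`. -/
theorem exists_isLeast_secular {D L : ℝ} (hD : 0 < D) (hL : 2 * D ≤ L) :
    ∃ κ : ℝ,
      IsLeast {k : ℝ | 0 < k ∧ Real.cos (2 * k * D) = (L - 2 * D) * k * Real.sin (2 * k * D)} κ ∧
      κ ^ 2 ≤ 2 / (D * L) := by
  have hL0 : 0 < L := by linarith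
  set f : ℝ → ℝ := fun k => Real.cos (2 * k * D) - (L - 2 * D) * k * Real.sin (2 * k * D) with hf
  have hcont : Continuous f := by fun_prop
  have hb : 0 < Real.pi / (4 * D) := by positivity
  have hbD : 2 * (Real.pi / (4 * D)) * D = Real.pi / 2 := by field_simp; ring
  have hf0 : f 0 = 1 := by simp [hf]
  have hfb : f (Real.pi / (4 * D)) ≤ 0 := by
    simp only [hf, hbD, Real.cos_pi_div_two, Real.sin_pi_div_two, mul_one, zero_sub]
    have : 0 ≤ (L - 2 * D) * (Real.pi / (4 * D)) := mul_nonneg (by linarith) hb.le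
    linarith
  -- At `π / (4 * D)` the cosine vanishes and `f ≤ 0`, while `f 0 = 1`; so a smallest zero exists in
  -- this compact interval.
  set K : Set ℝ := Set.Icc 0 (Real.pi / (4 * D)) ∩ f ⁻¹' {0} with hK
  have hKc : IsCompact K := isCompact_Icc.inter_right (isClosed_singleton.preimage hcont)
  have hKn : K.Nonempty := by
    obtain ⟨k, hk, hk0⟩ := intermediate_value_Icc' hb.le hcont.continuousOn
      (⟨hfb, by simp [hf0]⟩ : (0 : ℝ) ∈ Set.Icc (f (Real.pi / (4 * D))) (f 0))
    exact ⟨k, hk, hk0⟩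
  obtain ⟨κ, ⟨⟨hκ0, hκb⟩, hκf⟩, hκmin⟩ := hKc.exists_isLeast hKn
  have hκf : f κ = 0 := hκf
  have hκpos : 0 < κ := by
    refine lt_of_le_of_ne hκ0 fun h => ?_
    rw [← h, hf0] at hκf
    exact one_ne_zero hκf
  refine ⟨κ, ⟨⟨hκpos, sub_eq_zero.1 hκf⟩, ?_⟩, ?_⟩
  · rintro k ⟨hk, hkf⟩
    rcases le_total k (Real.pi / (4 * D)) with h | h
    · exact hκmin ⟨⟨hk.le, h⟩, sub_eq_zero.2 hkf⟩
    · exact hκb.trans h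
  · set t := 2 * κ * D with ht
    have ht0 : 0 < t := by positivity
    have ht1 : t ≤ Real.pi / 2 := by
      calc 2 * κ * D ≤ 2 * (Real.pi / (4 * D)) * D := by gcongr
        _ = Real.pi / 2 := hbD
    have heq : Real.cos t = (L - 2 * D) * κ * Real.sin t := sub_eq_zero.1 hκf
    have hts := Real.mul_cos_le_sin_of_le_pi_div_two ht0.le ht1
    have hcos0 : 0 ≤ Real.cos t := Real.cos_nonneg_of_mem_Icc ⟨by linarith, ht1⟩
    -- Multiply `t * cos t ≤ sin t` by `(L - 2 * D) * κ`, use the equation and cancel `cos t`; if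
    -- `cos t = 0`, the equation forces `L = 2 * D`.
    have hm : (L - 2 * D) * (2 * D * κ ^ 2) ≤ 1 := by
      rcases hcos0.eq_or_lt with hc | hc
      · have hs : 0 < Real.sin t := Real.sin_pos_of_pos_of_lt_pi ht0 (by linarith [Real.pi_pos])
        have : (L - 2 * D) * κ * Real.sin t = 0 := by rw [← heq, ← hc]
        have : L - 2 * D = 0 := by
          rcases mul_eq_zero.1 this with h | h
          · exact (mul_eq_zero.1 h).resolve_right hκpos.ne'
          · exact absurd h hs.ne'
        simp [this]
      · refine le_of_mul_le_mul_right ?_ hc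
        have := mul_le_mul_of_nonneg_left hts (mul_nonneg (sub_nonneg.2 hL) hκpos.le)
        rw [← heq, ht] at this
        rw [ht]
        linarith
    have hD2 : 4 * D ^ 2 * κ ^ 2 ≤ 5 / 2 := by
      have h3 : t ≤ 1.575 := by linarith [Real.pi_lt_d2]
      have := mul_self_le_mul_self ht0.le h3
      rw [ht] at this
      nlinarith
    -- Adding `hm` and `hD2` gives `2 * D * L * κ ^ 2 ≤ 7 / 2 < 4`.
    rw [le_div_iff₀ (by positivity)]
    nlinarith

/-! ### Hölder continuity along paths -/

namespace MetricGraph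

variable {V E : Type*} {G : MetricGraph V E}

theorem IsH1.eq_of_isAt {u u' : E → ℝ → ℝ} (hu : G.IsH1 u u') {x y : G.Point} {v : V}
    (hx : x.IsAt v) (hy : y.IsAt v) : u x.edge x.coord = u y.edge y.coord := by
  obtain ⟨c, hc⟩ := hu.2
  have key : ∀ z : G.Point, z.IsAt v → u z.edge z.coord = c v := by
    rintro z (⟨h0, rfl⟩ | ⟨h0, rfl⟩)
    · rw [h0, (hc _).1]
    · rw [h0, (hc _).2]
  rw [key x hx, key y hy]

theorem IsH1.exists_cover_segment [Fintype E] {u u' : E → ℝ → ℝ} (hu : G.IsH1 u u')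
    {x y : G.Point} (h : x.edge = y.edge) :
    ∃ S : E → Set ℝ, (∀ e, MeasurableSet (S e)) ∧ (∀ e, S e ⊆ Set.Icc 0 (G.len e)) ∧
      ∑ e, volume.real (S e) ≤ |x.coord - y.coord| ∧
      Set.uIcc (u x.edge x.coord) (u y.edge y.coord) ⊆ ⋃ e, u e '' S e := by
  classical
  obtain ⟨e, s, hs⟩ := x
  obtain ⟨e', t, ht⟩ := y
  obtain rfl : e = e' := h
  have hsub : Set.uIcc s t ⊆ Set.Icc 0 (G.len e) := Set.uIcc_subset_Icc hs ht
  refine ⟨fun i => if i = e then Set.uIcc s t else ∅, fun i => ?_, fun i => ?_, ?_, ?_⟩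
  · dsimp only
    split_ifs
    exacts [measurableSet_uIcc, MeasurableSet.empty]
  · dsimp only
    split_ifs with hi
    · exact hi ▸ hsub
    · exact Set.empty_subset _
  · rw [Finset.sum_eq_single e (fun i _ hi => by simp [hi]) (by simp)]
    simp [Measure.real, Real.volume_interval, abs_sub_comm]
  · refine (intermediate_value_uIcc ((hu.1 e).continuousOn.mono hsub)).trans ?_
    refine Set.subset_iUnion_of_subset e ?_
    simp

/-- The values of an `H¹` function along a path of length `ℓ` are taken on a set of measure at
most `ℓ`. -/
theorem HasPath.exists_cover [Fintype E] {u u' : E → ℝ → ℝ} (hu : G.IsH1 u u')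
    {x y : G.Point} {ℓ : ℝ} (p : G.HasPath x y ℓ) :
    ∃ S : E → Set ℝ, (∀ e, MeasurableSet (S e)) ∧ (∀ e, S e ⊆ Set.Icc 0 (G.len e)) ∧
      ∑ e, volume.real (S e) ≤ ℓ ∧
      Set.uIcc (u x.edge x.coord) (u y.edge y.coord) ⊆ ⋃ e, u e '' S e := by
  induction p with
  | segment x y h => exact hu.exists_cover_segment h
  | vertex x y v hx hy =>
    have := hu.exists_cover_segment (rfl : x.edge = x.edge)
    rw [sub_self, abs_zero] at this
    rwa [← hu.eq_of_isAt hx hy]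
  | trans x y z a b _ _ ih₁ ih₂ =>
    obtain ⟨S, hSm, hSs, hSl, hSc⟩ := ih₁
    obtain ⟨T, hTm, hTs, hTl, hTc⟩ := ih₂
    refine ⟨fun e => S e ∪ T e, fun e => (hSm e).union (hTm e),
      fun e => Set.union_subset (hSs e) (hTs e), ?_, ?_⟩
    · refine le_trans ?_ (add_le_add hSl hTl)
      rw [← Finset.sum_add_distrib]
      exact Finset.sum_le_sum fun e _ => measureReal_union_le _ _
    · refine (Set.uIcc_subset_uIcc_union_uIcc (b := u y.edge y.coord)).trans ?_
      refine Set.union_subset (hSc.trans ?_) (hTc.trans ?_)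
      · exact Set.iUnion_mono fun e => Set.image_mono Set.subset_union_left
      · exact Set.iUnion_mono fun e => Set.image_mono Set.subset_union_right

theorem HasPath.nonneg {x y : G.Point} {ℓ : ℝ} (p : G.HasPath x y ℓ) : 0 ≤ ℓ := by
  induction p with
  | segment => exact abs_nonneg _
  | vertex => exact le_rfl
  | trans _ _ _ _ _ _ _ h₁ h₂ => exact add_nonneg h₁ h₂

/-- An `H¹` function is Hölder continuous of exponent `1/2` along paths, where a path that runs
several times through the same edge need not be shortened first. -/
theorem HasPath.sq_sub_le [Fintype E] {u u' : E → ℝ → ℝ} (hu : G.IsH1 u u')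
    {x y : G.Point} {ℓ : ℝ} (p : G.HasPath x y ℓ) :
    (u x.edge x.coord - u y.edge y.coord) ^ 2 ≤ ℓ * G.integral fun e x => u' e x ^ 2 := by
  set δ := |u x.edge x.coord - u y.edge y.coord| with hδ
  set M := G.integral fun e x => u' e x ^ 2 with hM
  have hM0 : 0 ≤ M := Finset.sum_nonneg fun e _ =>
    intervalIntegral.integral_nonneg (G.len_pos e).le fun _ _ => sq_nonneg _
  obtain ⟨S, hSm, hSs, hSl, hSc⟩ := p.exists_cover hu
  have hδS : δ ≤ ∑ e, ∫ t in S e, |u' e t| := by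
    have hnn : ∀ e ∈ Finset.univ, 0 ≤ ∫ t in S e, |u' e t| :=
      fun e _ => integral_nonneg fun t => abs_nonneg _
    rw [← ENNReal.ofReal_le_ofReal_iff (Finset.sum_nonneg hnn), ENNReal.ofReal_sum_of_nonneg hnn,
      hδ, abs_sub_comm, ← Real.volume_interval]
    calc volume (Set.uIcc (u x.edge x.coord) (u y.edge y.coord))
        ≤ volume (⋃ e, u e '' S e) := measure_mono hSc
      _ ≤ ∑ e, volume (u e '' S e) := measure_iUnion_fintype_le _ _
      _ ≤ _ := Finset.sum_le_sum fun e _ => (hu.1 e).volume_image_le (hSm e) (hSs e)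
  -- The Cauchy–Schwarz bound with parameter `r` is linear in the integrals, so it sums over the
  -- edges; the discriminant then optimizes `r`.
  have hquad : ∀ r : ℝ, 0 ≤ M * (r * r) + (-(2 * δ)) * r + ℓ := by
    intro r
    have hδ0 : 0 ≤ δ := abs_nonneg _
    rcases le_or_gt r 0 with hr | hr
    · have := mul_nonneg hM0 (mul_self_nonneg r)
      have := mul_nonneg hδ0 (neg_nonneg.2 hr)
      have := p.nonneg
      linarith
    · have h1 : ∑ e, 2 * r * ∫ t in S e, |u' e t| ≤
          ∑ e, (r ^ 2 * (∫ t in (0 : ℝ)..G.len e, u' e t ^ 2) + volume.real (S e)) :=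
        Finset.sum_le_sum fun e _ => (hu.1 e).setIntegral_abs_le (G.len_pos e).le (hSs e) r
      rw [← Finset.mul_sum, Finset.sum_add_distrib, ← Finset.mul_sum] at h1
      have h2 := mul_le_mul_of_nonneg_left hδS (by positivity : 0 ≤ 2 * r)
      have h3 : M = ∑ e, ∫ t in (0 : ℝ)..G.len e, u' e t ^ 2 := rfl
      rw [← h3] at h1
      linarith
  have := discrim_le_zero hquad
  rw [discrim] at this
  rw [← sq_abs]
  linarith

/-! ### Connectedness and the diameter -/

theorem Connected.exists_hasPath (hG : G.Connected) (x y : G.Point) : ∃ ℓ, G.HasPath x y ℓ := by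
  let R : V → V → Prop := fun v w => ∀ x : G.Point, x.IsAt v → ∃ y : G.Point, y.IsAt w ∧
    ∃ ℓ, G.HasPath x y ℓ
  -- Both directions are proved together so that the symmetry case of the induction is immediate.
  have hR : ∀ v w, R v w ∧ R w v := by
    intro v w
    induction hG.2 v w with
    | rel a b h =>
      obtain ⟨e, rfl, rfl⟩ := h
      let s : G.Point := ⟨e, 0, le_rfl, (G.len_pos e).le⟩
      let t : G.Point := ⟨e, G.len e, (G.len_pos e).le, le_rfl⟩
      have hs : s.IsAt (G.src e) := Or.inl ⟨rfl, rfl⟩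
      have ht : t.IsAt (G.tgt e) := Or.inr ⟨rfl, rfl⟩
      exact ⟨fun x hx => ⟨t, ht, _, .trans _ _ _ _ _ (.vertex x s _ hx hs) (.segment s t rfl)⟩,
        fun x hx => ⟨s, hs, _, .trans _ _ _ _ _ (.vertex x t _ hx ht) (.segment t s rfl)⟩⟩
    | refl a => exact ⟨fun x hx => ⟨x, hx, _, .vertex x x a hx hx⟩,
        fun x hx => ⟨x, hx, _, .vertex x x a hx hx⟩⟩
    | symm a b _ ih => exact ih.symm
    | trans a b c _ _ ih₁ ih₂ =>
      have htrans : ∀ {a b c}, R a b → R b c → R a c := by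
        intro a b c hab hbc x hx
        obtain ⟨y, hy, ℓ₁, p₁⟩ := hab x hx
        obtain ⟨z, hz, ℓ₂, p₂⟩ := hbc y hy
        exact ⟨z, hz, _, p₁.trans _ _ _ _ _ p₂⟩
      exact ⟨htrans ih₁.1 ih₂.1, htrans ih₂.2 ih₁.2⟩
  let s : G.Point := ⟨x.edge, 0, le_rfl, (G.len_pos _).le⟩
  let t : G.Point := ⟨y.edge, 0, le_rfl, (G.len_pos _).le⟩
  obtain ⟨z, hz, ℓ, p⟩ := (hR (G.src x.edge) (G.src y.edge)).1 s (Or.inl ⟨rfl, rfl⟩)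
  exact ⟨_, .trans _ _ _ _ _ (.segment x s rfl) (.trans _ _ _ _ _ p
    (.trans _ _ _ _ _ (.vertex z t _ hz (Or.inl ⟨rfl, rfl⟩)) (.segment t y rfl)))⟩

/-- `sSup` of an unbounded set is `0`, so a nonzero diameter is a genuine supremum. -/
theorem dist_le_diameter (h : G.diameter ≠ 0) (x y : G.Point) : G.dist x y ≤ G.diameter := by
  refine le_csSup ?_ ⟨x, y, rfl⟩
  by_contra hb
  exact h (Real.sSup_of_not_bddAbove hb)

theorem IsH1.sq_sub_le_diameter_mul [Fintype E] (hG : G.Connected) (hD : G.diameter ≠ 0)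
    {u u' : E → ℝ → ℝ} (hu : G.IsH1 u u') (x y : G.Point) :
    (u x.edge x.coord - u y.edge y.coord) ^ 2 ≤
      G.diameter * G.integral fun e x => u' e x ^ 2 := by
  set M := G.integral fun e x => u' e x ^ 2 with hM
  have hM0 : 0 ≤ M := Finset.sum_nonneg fun e _ =>
    intervalIntegral.integral_nonneg (G.len_pos e).le fun _ _ => sq_nonneg _
  refine le_trans ?_ (mul_le_mul_of_nonneg_right (dist_le_diameter hD x y) hM0)
  -- Some path must exist, since `sInf ∅ = 0` would make the distance meaningless.
  obtain ⟨ℓ₀, p₀⟩ := hG.exists_hasPath x y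
  rcases hM0.eq_or_lt with h0 | h0
  · have := p₀.sq_sub_le hu
    rw [← hM, ← h0, mul_zero] at this
    rwa [← h0, mul_zero]
  · rw [← div_le_iff₀ h0]
    refine le_csInf ⟨ℓ₀, p₀⟩ fun ℓ p => ?_
    rw [div_le_iff₀ h0]
    exact p.sq_sub_le hu

/-! ### Integration over the graph and the Poincaré inequality -/

section Integral

variable [Fintype E]

theorem integral_add {f g : E → ℝ → ℝ}
    (hf : ∀ e, IntervalIntegrable (f e) volume 0 (G.len e))
    (hg : ∀ e, IntervalIntegrable (g e) volume 0 (G.len e)) :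
    G.integral (fun e x => f e x + g e x) = G.integral f + G.integral g := by
  simp only [integral]
  rw [← Finset.sum_add_distrib]
  exact Finset.sum_congr rfl fun e _ => intervalIntegral.integral_add (hf e) (hg e)

theorem integral_const_mul (c : ℝ) (f : E → ℝ → ℝ) :
    G.integral (fun e x => c * f e x) = c * G.integral f := by
  simp [integral, Finset.mul_sum]

theorem integral_const (c : ℝ) : G.integral (fun _ _ => c) = G.totalLength * c := by
  simp [integral, totalLength, Finset.sum_mul]

theorem integral_mono {f g : E → ℝ → ℝ}
    (hf : ∀ e, IntervalIntegrable (f e) volume 0 (G.len e))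
    (hg : ∀ e, IntervalIntegrable (g e) volume 0 (G.len e))
    (h : ∀ e, ∀ x ∈ Set.Icc 0 (G.len e), f e x ≤ g e x) : G.integral f ≤ G.integral g :=
  Finset.sum_le_sum fun e _ =>
    intervalIntegral.integral_mono_on (G.len_pos e).le (hf e) (hg e) (h e)

end Integral

theorem IsH1.intervalIntegrable {u u' : E → ℝ → ℝ} (hu : G.IsH1 u u') (e : E) :
    IntervalIntegrable (u e) volume 0 (G.len e) :=
  (hu.1 e).continuousOn.intervalIntegrable_of_Icc (G.len_pos e).le

theorem IsH1.intervalIntegrable_sq {u u' : E → ℝ → ℝ} (hu : G.IsH1 u u') (e : E) :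
    IntervalIntegrable (fun x => u e x ^ 2) volume 0 (G.len e) :=
  ((hu.1 e).continuousOn.pow 2).intervalIntegrable_of_Icc (G.len_pos e).le

/-- Poincaré inequality: `2 ‖u‖² ≤ D L ‖u'‖²` for `u ∈ H¹(G)` of mean zero. -/
theorem IsH1.poincare [Fintype E] (hG : G.Connected) (hD : G.diameter ≠ 0)
    (hL : 0 < G.totalLength) {u u' : E → ℝ → ℝ} (hu : G.IsH1 u u') (h0 : G.integral u = 0) :
    2 * G.integral (fun e x => u e x ^ 2) ≤
      G.diameter * G.totalLength * G.integral fun e x => u' e x ^ 2 := by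
  set M := G.integral fun e x => u' e x ^ 2 with hM
  set N := G.integral fun e x => u e x ^ 2 with hN
  have hcont : ∀ (c : ℝ) e, IntervalIntegrable (fun _ => c) volume 0 (G.len e) :=
    fun _ _ => intervalIntegrable_const
  -- Integrate the pointwise bound in the first variable; the cross term drops out because `u` has
  -- mean zero.
  have key : ∀ e, ∀ t ∈ Set.Icc 0 (G.len e),
      N + G.totalLength * u e t ^ 2 ≤ G.totalLength * (G.diameter * M) := by
    intro e t ht
    have h1 : G.integral (fun i x => u i x ^ 2 + ((-(2 * u e t)) * u i x + u e t ^ 2)) ≤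
        G.integral fun _ _ => G.diameter * M := by
      refine integral_mono (fun i => (hu.intervalIntegrable_sq i).add
        (((hu.intervalIntegrable i).const_mul _).add (hcont _ i))) (hcont _) fun i s hs => ?_
      have := hu.sq_sub_le_diameter_mul hG hD ⟨i, s, hs⟩ ⟨e, t, ht⟩
      simp only [← hM] at this
      linarith
    rw [integral_add hu.intervalIntegrable_sq fun i =>
      ((hu.intervalIntegrable i).const_mul _).add (hcont _ i),
      integral_add (fun i => (hu.intervalIntegrable i).const_mul _) (hcont _),
      integral_const_mul, integral_const, integral_const, h0, mul_zero, zero_add] at h1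
    exact h1
  have h2 := integral_mono (fun e => (hcont N e).add
    ((hu.intervalIntegrable_sq e).const_mul G.totalLength)) (hcont _) key
  rw [integral_add (hcont N) fun e => (hu.intervalIntegrable_sq e).const_mul _, integral_const,
    integral_const_mul, integral_const, ← hN] at h2
  refine le_of_mul_le_mul_left ?_ hL
  linarith

/-! ### Eigenfunctions and Green's identity -/

theorem HasH1Deriv.hasDerivAt {a : ℝ} {f g : ℝ → ℝ} (h : HasH1Deriv a f g)
    (hg : ContinuousOn g (Set.Icc 0 a)) {x : ℝ} (hx : x ∈ Set.Ioo 0 a) :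
    HasDerivAt f (g x) x := by
  have hnhds : Set.Icc 0 a ∈ nhds x := Icc_mem_nhds hx.1 hx.2
  have hd : HasDerivAt (fun y => f 0 + ∫ t in (0 : ℝ)..y, g t) (g x) x := by
    refine HasDerivAt.const_add _ (intervalIntegral.integral_hasDerivAt_right ?_ ?_ ?_)
    · exact (hg.mono (Set.Icc_subset_Icc le_rfl hx.2.le)).intervalIntegrable_of_Icc hx.1.le
    · exact ⟨Set.Icc 0 a, hnhds, hg.aestronglyMeasurable measurableSet_Icc⟩
    · exact hg.continuousAt hnhds
  refine hd.congr_of_eventuallyEq ?_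
  filter_upwards [hnhds] with y hy using h.2 y hy

theorem hasH1Deriv_of_hasDerivAt {a : ℝ} {f g : ℝ → ℝ} (hf : ∀ x, HasDerivAt f (g x) x)
    (hg : Continuous g) : HasH1Deriv a f g := by
  refine ⟨?_, fun x _ => ?_⟩
  · rw [memLp_two_iff_integrable_sq hg.aestronglyMeasurable]
    exact (hg.pow 2).continuousOn.integrableOn_Icc.mono_set Set.Ioc_subset_Icc_self
  · rw [intervalIntegral.integral_eq_sub_of_hasDerivAt (fun y _ => hf y)
      (hg.intervalIntegrable _ _)]
    ring

/-- Summation over the edge ends against a function on the vertices. -/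
theorem Kirchhoff.sum_eq_zero [Fintype E] {u' : E → ℝ → ℝ} (h : G.Kirchhoff u') (c : V → ℝ) :
    ∑ e, (c (G.tgt e) * u' e (G.len e) - c (G.src e) * u' e 0) = 0 := by
  classical
  -- `V` need not be finite, so the sum runs over the endpoints of edges only.
  set T : Finset V := Finset.univ.image G.src ∪ Finset.univ.image G.tgt with hT
  have hsrc : ∀ e, G.src e ∈ T := fun e => by simp [hT]
  have htgt : ∀ e, G.tgt e ∈ T := fun e => by simp [hT]
  have hsum : ∀ (p : E → V) (w : E → ℝ), (∀ e, p e ∈ T) →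
      ∑ v ∈ T, c v * ∑ e, (if p e = v then w e else 0) = ∑ e, c (p e) * w e := by
    intro p w hp
    simp only [Finset.mul_sum]
    rw [Finset.sum_comm]
    refine Finset.sum_congr rfl fun e _ => ?_
    rw [Finset.sum_eq_single (p e) (fun v _ hv => by simp [hv.symm])
      (fun he => absurd (hp e) he)]
    simp
  have h0 : ∑ v ∈ T, c v * ((∑ e, if G.src e = v then u' e 0 else 0) +
      ∑ e, if G.tgt e = v then -u' e (G.len e) else 0) = 0 :=
    Finset.sum_eq_zero fun v _ => by
      rw [mul_eq_zero]
      right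
      convert h v
  simp only [mul_add] at h0
  rw [Finset.sum_add_distrib, hsum _ _ hsrc, hsum _ _ htgt] at h0
  rw [Finset.sum_sub_distrib]
  simp only [mul_neg, Finset.sum_neg_distrib] at h0
  linarith

section Eigenfunction

variable [Fintype E] {u u' : E → ℝ → ℝ} {μ : ℝ}

/-- Green's identity against the constant `1`: eigenfunctions for `μ ≠ 0` have mean zero. -/
theorem mul_integral_eq_zero_of_eigenfunction (hK : G.Kirchhoff u')
    (hu' : ∀ e, HasH1Deriv (G.len e) (u' e) fun x => -(μ * u e x)) :
    μ * G.integral u = 0 := by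
  have h := hK.sum_eq_zero fun _ => 1
  simp only [one_mul] at h
  rw [integral, Finset.mul_sum, ← neg_eq_zero, ← Finset.sum_neg_distrib]
  refine (Finset.sum_congr rfl fun e _ => ?_).trans h
  rw [(hu' e).2 _ ⟨(G.len_pos e).le, le_rfl⟩, intervalIntegral.integral_neg,
    intervalIntegral.integral_const_mul]
  ring

/-- On each edge `(u * u')' = u' ^ 2 - μ * u ^ 2`; the boundary terms cancel by the Kirchhoff
condition weighted with the vertex values of `u`. -/
theorem integral_sq_deriv_of_eigenfunction (hu : G.IsH1 u u') (hK : G.Kirchhoff u')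
    (hu' : ∀ e, HasH1Deriv (G.len e) (u' e) fun x => -(μ * u e x)) :
    (G.integral fun e x => u' e x ^ 2) = μ * G.integral fun e x => u e x ^ 2 := by
  obtain ⟨c, hc⟩ := hu.2
  have h := hK.sum_eq_zero c
  have hedge : ∀ e, (∫ x in (0 : ℝ)..G.len e, u' e x ^ 2) -
      μ * (∫ x in (0 : ℝ)..G.len e, u e x ^ 2) =
      c (G.tgt e) * u' e (G.len e) - c (G.src e) * u' e 0 := by
    intro e
    have hle := (G.len_pos e).le
    have hcu := (hu.1 e).continuousOn
    have hcu' := (hu' e).continuousOn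
    have hi1 : IntervalIntegrable (fun x => u' e x ^ 2) volume 0 (G.len e) :=
      (hcu'.pow 2).intervalIntegrable_of_Icc hle
    have hi2 : IntervalIntegrable (fun x => μ * u e x ^ 2) volume 0 (G.len e) :=
      (continuousOn_const.mul (hcu.pow 2)).intervalIntegrable_of_Icc hle
    rw [← intervalIntegral.integral_const_mul, ← intervalIntegral.integral_sub hi1 hi2,
      ← (hc e).1, ← (hc e).2]
    refine intervalIntegral.integral_eq_sub_of_hasDerivAt_of_le hle (f := fun x => u e x * u' e x)
      (hcu.mul hcu') (fun x hx => ?_) (hi1.sub hi2)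
    have := ((hu.1 e).hasDerivAt hcu' hx).mul
      ((hu' e).hasDerivAt (continuousOn_const.mul hcu).neg hx)
    refine this.congr_deriv ?_
    ring
  rw [← sub_eq_zero, integral, integral, Finset.mul_sum, ← Finset.sum_sub_distrib]
  exact (Finset.sum_congr rfl fun e _ => hedge e).trans h

end Eigenfunction

theorem IsH1.integral_sq_pos [Fintype E] {u u' : E → ℝ → ℝ} (hu : G.IsH1 u u')
    (h : ∃ e, ∃ x ∈ Set.Icc 0 (G.len e), u e x ≠ 0) :
    0 < G.integral fun e x => u e x ^ 2 := by
  obtain ⟨e, x, hx, hne⟩ := h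
  refine Finset.sum_pos' (fun i _ => intervalIntegral.integral_nonneg (G.len_pos i).le
    fun _ _ => sq_nonneg _) ⟨e, Finset.mem_univ _, ?_⟩
  exact intervalIntegral.integral_pos (G.len_pos e) ((hu.1 e).continuousOn.pow 2)
    (fun _ _ => sq_nonneg _) ⟨x, hx, by positivity⟩

theorem IsEigenvalue.le_of_poincare [Fintype E] (hG : G.Connected) (hD : 0 < G.diameter)
    (hL : 0 < G.totalLength) {μ : ℝ} (h : G.IsEigenvalue μ) (hμ : μ ≠ 0) :
    2 / (G.diameter * G.totalLength) ≤ μ := by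
  obtain ⟨u, hne, u', hu, hK, hu'⟩ := h
  have h0 := (mul_eq_zero.1 (mul_integral_eq_zero_of_eigenfunction hK hu')).resolve_left hμ
  have hpos := hu.integral_sq_pos hne
  have hp := hu.poincare hG hD.ne' hL h0
  rw [integral_sq_deriv_of_eigenfunction hu hK hu', ← mul_assoc] at hp
  rw [div_le_iff₀ (mul_pos hD hL), mul_comm μ]
  exact le_of_mul_le_mul_right hp hpos

/-! ### The Rayleigh infimum -/

/-- On a graph with at least one edge there is a nonzero `H¹` function of mean zero. -/
theorem exists_isH1_integral_eq_zero [Fintype E] (G : MetricGraph V E) (e₀ : E) :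
    ∃ u u' : E → ℝ → ℝ, G.IsH1 u u' ∧ G.integral u = 0 ∧
      0 < G.integral fun e x => u e x ^ 2 := by
  classical
  set a := G.len e₀ with ha
  have ha0 : 0 < a := G.len_pos e₀
  -- `p x = x * (x - a) * (2 * x - a)` vanishes at both ends and is odd about the midpoint.
  set p : ℝ → ℝ := fun x => 2 * x ^ 3 - 3 * a * x ^ 2 + a ^ 2 * x with hp
  set p' : ℝ → ℝ := fun x => 6 * x ^ 2 - 6 * a * x + a ^ 2 with hp'
  have hd : ∀ x, HasDerivAt p (p' x) x := by
    intro x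
    have := (((hasDerivAt_pow 3 x).const_mul 2).sub ((hasDerivAt_pow 2 x).const_mul (3 * a))).add
      ((hasDerivAt_id x).const_mul (a ^ 2))
    refine this.congr_deriv ?_
    simp only [hp']
    norm_num
    ring
  have hint : ∫ x in (0 : ℝ)..a, p x = 0 := by
    have hq : ∀ x, HasDerivAt (fun x => x ^ 2 * (a - x) ^ 2 / 2) (p x) x := by
      intro x
      have := (((hasDerivAt_pow 2 x).mul (((hasDerivAt_id x).const_sub a).pow 2)).div_const 2)
      refine this.congr_deriv ?_
      simp only [hp, id]
      norm_num
      ring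
    rw [intervalIntegral.integral_eq_sub_of_hasDerivAt (fun x _ => hq x)
      ((by fun_prop : Continuous p).intervalIntegrable _ _)]
    simp
  have hu : G.IsH1 (fun e x => if e = e₀ then p x else 0)
      (fun e x => if e = e₀ then p' x else 0) := by
    refine ⟨fun e => ?_, fun _ => 0, fun e => ?_⟩
    · by_cases he : e = e₀
      · simp only [he, if_true]
        exact hasH1Deriv_of_hasDerivAt hd (by fun_prop)
      · simp only [he, if_false]
        exact hasH1Deriv_of_hasDerivAt (fun x => hasDerivAt_const x 0) continuous_const
    · by_cases he : e = e₀
      · subst he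
        simp only [if_true, hp]
        constructor <;> ring
      · simp [he]
  refine ⟨_, _, hu, ?_, hu.integral_sq_pos ⟨e₀, a / 4, ⟨by positivity, by linarith⟩, ?_⟩⟩
  · refine Finset.sum_eq_zero fun e _ => ?_
    by_cases he : e = e₀
    · subst he
      simpa using hint
    · simp [he]
  · simp only [if_true, hp]
    have : 2 * (a / 4) ^ 3 - 3 * a * (a / 4) ^ 2 + a ^ 2 * (a / 4) = 3 / 32 * a ^ 3 := by ring
    rw [this]
    positivity

theorem le_lambda1 [Fintype E] (hG : G.Connected) (hD : 0 < G.diameter)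
    (hL : 0 < G.totalLength) : 2 / (G.diameter * G.totalLength) ≤ G.lambda1 := by
  obtain ⟨e₀, -, -⟩ := Finset.exists_ne_zero_of_sum_ne_zero hL.ne'
  obtain ⟨v, v', hv, hv0, hvpos⟩ := G.exists_isH1_integral_eq_zero e₀
  -- A competitor is needed here: the infimum of an empty set would be `0`.
  refine le_csInf ⟨_, v, v', hv, hv0, hvpos, rfl⟩ ?_
  rintro _ ⟨u, u', hu, h0, hpos, rfl⟩
  rw [div_le_div_iff₀ (mul_pos hD hL) hpos, mul_comm (G.integral _) (G.diameter * _)]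
  exact hu.poincare hG hD.ne' hL h0

end MetricGraph

/-! ### Conclusion -/

theorem mainTheorem3 {V E : Type*} [Fintype E] (G : MetricGraph V E) (hG : G.Connected)
    (D L : ℝ) (hdiam : G.diameter = D) (hlen : G.totalLength = L)
    (hD : 0 < D) (hL : 2 * D ≤ L) :
    ∃ κ : ℝ,
      IsLeast {k : ℝ | 0 < k ∧ Real.cos (2 * k * D) = (L - 2 * D) * k * Real.sin (2 * k * D)} κ ∧
      κ ^ 2 ≤ G.lambda1 ∧
      (∀ μ : ℝ, G.IsEigenvalue μ → μ ≠ 0 → κ ^ 2 ≤ μ) ∧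
      1 / (2 * D * (L - D)) ≤ G.lambda1 ∧
      (∀ μ : ℝ, G.IsEigenvalue μ → μ ≠ 0 → 1 / (2 * D * (L - D)) ≤ μ) ∧
      1 / (2 * D * L) < 1 / (2 * D * (L - D)) := by
  obtain ⟨κ, hκ, hκle⟩ := exists_isLeast_secular hD hL
  have hL0 : 0 < L := by linarith
  have hLD : 0 < L - D := by linarith
  -- The explicit bound also comes from `2 / (D * L)`, not from `κ`: it amounts to `4 * D ≤ 3 * L`.
  have hbound : 1 / (2 * D * (L - D)) ≤ 2 / (D * L) := by
    rw [div_le_div_iff₀ (by positivity) (by positivity)]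
    nlinarith
  subst hdiam hlen
  have hlam := MetricGraph.le_lambda1 hG hD hL0
  have heig := fun μ (h : G.IsEigenvalue μ) (hμ : μ ≠ 0) => h.le_of_poincare hG hD hL0 hμ
  refine ⟨κ, hκ, hκle.trans hlam, fun μ h hμ => hκle.trans (heig μ h hμ), hbound.trans hlam,
    fun μ h hμ => hbound.trans (heig μ h hμ), ?_⟩
  apply one_div_lt_one_div_of_lt (by positivity)
  nlinarith
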